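/- Let $r\le m$ be positive integers, $N=2^m$, $p\in(0,\tfrac12)$, and let $\mathbf Y\sim\mathrm{Ber}^{\otimes N}(p)$ be the word received when the all-zeros codeword of the Reed–Muller code $\mathrm{RM}(m,r)$ is sent over the binary symmetric channel $\mathrm{BSC}(p)$; its coordinates are indexed by $\{0,1\}^m$. For a vector $\mathbf y$ indexed by $\{0,1\}^n$ and a one-dimensional subspace $\mathbb B$ of $\{0,1\}^n$, the projection $\mathbf y_{/\mathbb B}$ is the vector whose entry at a coset $T$ of $\mathbb B$ is $\bigoplus_{\mathbf x\in T}y_{\mathbf x}$; for some fixed ordering of the cosets it is indexed by $\{0,1\}^{n-1}$. Write $\mathbf y_{/(\mathbb S^{(1)},\dots,\mathbb S^{(j)})}$ for successive projections, where $\mathbb S^{(i)}$ is a one-dimensional subspace of $\{0,1\}^{m-i+1}$. The recursive projection–aggregation (RPA) decoder for $\mathrm{RM}(n,s)$, $s\ge2$, with at most $M\ge1$ iterations, repeats the following step up to $M$ times on its current word $\mathbf y$ (initially its input), stopping if a step leaves $\mathbf y$ unchanged, and returns the current word. For every one-dimensional subspace $\mathbb B\subseteq\{0,1\}^n$ decode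 $\mathbf y_{/\mathbb B}$ to an estimate $\widehat{\mathbf y}_{/\mathbb B}$, by the RPA decoder for $\mathrm{RM}(n-1,s-1)$ if $s>2$ and by a maximum-likelihood (nearest codeword, ties broken arbitrarily) decoder for $\mathrm{RM}(n-1,1)$ if $s=2$; then flip each coordinate $y_{\mathbf x}$ for which the number of $\mathbb B$ with $y_{/\mathbb B}([\mathbf x+\mathbb B])\neq\widehat y_{/\mathbb B}([\mathbf x+\mathbb B])$ exceeds $\frac{2^n-1}{2}$. Put $p^{(i)}=\tfrac12\bigl(1-(1-2p)^{2^i}\bigr)$, $N^{(i)}=N/2^i$ and $\eta(\alpha)=\tfrac12\bigl(1-4\alpha(1-\alpha)\bigr)$. For $1\le j\le r-2$ and a fixed path $\overline{\mathbb S}^{(1)},\dots,\overline{\mathbb S}^{(j-1)}$, let $\widehat{\mathbf Y}_{/(\overline{\mathbb S}^{(1)},\dots,\overline{\mathbb S}^{(j-1)},\mathbb S^{(j)})}$ be the output of the RPA decoder for $\mathrm{RM}(m-j,r-j)$ on $\mathbf Y_{/(\overline{\mathbb S}^{(1)},\dots,\overline{\mathbb S}^{(j-1)},\mathbb S^{(j)})}$,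 and let $$\mathcal G^{(j)}=\Bigl\{\widehat{\mathbf Y}_{/(\overline{\mathbb S}^{(1)},\dots,\overline{\mathbb S}^{(j-1)},\mathbb S^{(j)})}=\mathbf 0\ \text{ for all one-dimensional } \mathbb S^{(j)}\subseteq\{0,1\}^{m-j+1}\Bigr\}.$$ Then for every $M\ge1$, every $j\in\{1,\dots,r-2\}$, every such path and every $0<\epsilon<\eta(p^{(r-2)})$, $$\Pr\bigl[\mathcal G^{(j)}\bigr]\ \ge\ 1-2^{\,r+3-j}\,\bigl(N^{(j)}\bigr)^{r+2-j}\,e^{-N^{(r-2)}\epsilon^2/8}.$$ -/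

import Mathlib

open MeasureTheory ProbabilityTheory

namespace RPA

/-- The Boolean cube `{0,1}^m`, as a vector space over the field with two elements. -/
abbrev Cube (m : ℕ) : Type := Fin m → ZMod 2

/-- Binary vectors of length `2 ^ m`, with coordinates indexed by the points of `{0,1}^m`. -/
abbrev Word (m : ℕ) : Type := Cube m → ZMod 2

/-- The Reed-Muller code RM(m, r): evaluation vectors of the polynomials of degree at most `r`. -/
def reedMuller (m r : ℕ) : Set (Word m) :=
  {c | ∃ f : MvPolynomial (Fin m) (ZMod 2),
    f.totalDegree ≤ r ∧ ∀ z : Cube m, c z = MvPolynomial.eval z f}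

/-- The one-dimensional subspaces of `{0,1}^m`. -/
abbrev Line (m : ℕ) : Type :=
  {B : Submodule (ZMod 2) (Cube m) // Module.finrank (ZMod 2) B = 1}

/-- The projection of `y` onto the cosets of `B`: the entry at a coset `T` is the modulo-2 sum of
the coordinates of `y` whose indices lie in `T`. -/
noncomputable def project {m : ℕ} (B : Line m) (y : Word m) : (Cube m ⧸ B.1) → ZMod 2 := by
  classical
  exact fun T => ∑ x : Cube m with Submodule.Quotient.mk x = T, y x

/-- A fixed ordering of the cosets of every one-dimensional subspace `B` of `{0,1}^(n+1)`, that is,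
an indexing of them by the points of `{0,1}^n`. -/
abbrev CosetOrdering : Type := ∀ (n : ℕ) (B : Line (n + 1)), (Cube (n + 1) ⧸ B.1) ≃ Cube n

/-- The projection as a vector of length `2 ^ n`, after indexing the cosets by `{0,1}^n`. -/
noncomputable def projectWord (σ : CosetOrdering) {n : ℕ} (B : Line (n + 1)) (y : Word (n + 1)) :
    Word n :=
  fun z => project B y ((σ n B).symm z)

/-- `D` is a maximum likelihood decoder for first-order Reed-Muller codes over the binary symmetric
channel: it returns a codeword of RM(n, 1) nearest to its input; ties are broken in any way. -/
def IsFirstOrderML (D : ∀ n : ℕ, Word n → Word n) : Prop :=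
  ∀ (n : ℕ) (y : Word n), D n y ∈ reedMuller n 1 ∧
    ∀ c ∈ reedMuller n 1, hammingDist y (D n y) ≤ hammingDist y c

/-- `φ(x)`: the number of one-dimensional subspaces `B` for which the projection of `y` and the
estimate `est B` of that projection disagree at the coset of `x`. -/
noncomputable def disagreements (σ : CosetOrdering) {n : ℕ} (y : Word (n + 1))
    (est : Line (n + 1) → Word n) (x : Cube (n + 1)) : ℕ :=
  {B : Line (n + 1) | projectWord σ B y (σ n B (Submodule.Quotient.mk x)) ≠
    est B (σ n B (Submodule.Quotient.mk x))}.ncard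

/-- The vector `Flip`: its entry at `x` is one if `φ(x)` exceeds half the number of subspaces. -/
noncomputable def flipVector (σ : CosetOrdering) {n : ℕ} (y : Word (n + 1))
    (est : Line (n + 1) → Word n) : Word (n + 1) := by
  classical
  exact fun x =>
    if (Nat.card (Line (n + 1)) : ℝ) / 2 < (disagreements σ y est x : ℝ) then 1 else 0

/-- The aggregation subroutine. -/
noncomputable def aggregate (σ : CosetOrdering) {n : ℕ} (y : Word (n + 1))
    (est : Line (n + 1) → Word n) : Word (n + 1) :=
  y + flipVector σ y est

/-- At most `M` rounds of `y ← step y`, stopping as soon as a round leaves `y` unchanged. -/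
noncomputable def iterateUntilFixed {α : Type} (step : α → α) : ℕ → α → α
  | 0, y => y
  | M + 1, y => by
    classical
    exact if y = step y then y else iterateUntilFixed step M (step y)

/-- The decoder used for RM(m, r), where `M` is the maximal number of iterations: the
maximum likelihood decoder `D` if `r = 1`, and the RPA decoder with one-dimensional subspaces if
`r ≥ 2`. The lines with `r = 0`, or with `m = 0` and `r ≥ 2`, are placeholders; they are never
reached from `1 ≤ r ≤ m`. -/
noncomputable def decode (σ : CosetOrdering) (D : ∀ n : ℕ, Word n → Word n) (M : ℕ) :
    (r m : ℕ) → Word m → Word m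
  | 0, _, y => y
  | 1, m, y => D m y
  | _ + 2, 0, y => y
  | r + 2, n + 1, y =>
    iterateUntilFixed
      (fun z : Word (n + 1) => aggregate σ z fun B => decode σ D M (r + 1) n (projectWord σ B z))
      M y

/-- A path down the projection-aggregation tree: a sequence of one-dimensional subspaces
`S⁽¹⁾ ⊆ {0,1}^m`, `S⁽²⁾ ⊆ {0,1}^(m-1)`, …, the last one lying in `{0,1}^(n+1)`; so a
`Path m n` leads from the root, of length `2 ^ m`, to a node of length `2 ^ n` at level `m - n`. -/
inductive Path (m : ℕ) : ℕ → Type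
  | root : Path m m
  | snoc {n : ℕ} (P : Path m (n + 1)) (S : Line (n + 1)) : Path m n

/-- The successive projection of `y` along a path. -/
noncomputable def projectAlong (σ : CosetOrdering) {m : ℕ} :
    {n : ℕ} → Path m n → Word m → Word n
  | _, Path.root, y => y
  | _, Path.snoc P S, y => projectWord σ S (projectAlong σ P y)

/-- The estimate passed upwards from the child, reached through the subspace `S`, of the node `P`;
`s` is the order of the Reed-Muller code at that child. -/
noncomputable def childEstimate (σ : CosetOrdering) (D : ∀ n : ℕ, Word n → Word n) (M s : ℕ)
    {m n : ℕ} (P : Path m (n + 1)) (S : Line (n + 1)) (y : Word m) : Word n :=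
  decode σ D M s n (projectAlong σ (P.snoc S) y)

/-- `p⁽ʲ⁾ = (1 - (1 - 2p)^(2^j)) / 2`. -/
noncomputable def pLevel (p : ℝ) (j : ℕ) : ℝ := (1 - (1 - 2 * p) ^ (2 ^ j)) / 2

/-- `η(α) = (1 - 4α(1 - α)) / 2`. -/
noncomputable def eta (α : ℝ) : ℝ := (1 - 4 * α * (1 - α)) / 2

/-- `N⁽ʲ⁾ = N / 2^j`, where `N = 2^m`. -/
noncomputable def nLevel (m j : ℕ) : ℝ := (2 : ℝ) ^ m / 2 ^ j

/-- `Y ∼ Ber^{⊗N}(p)` with `N = 2^m`: the word received when the all-zeros word is sent over the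
binary symmetric channel with crossover probability `p`. -/
def IsBernoulliWord {Ω : Type*} [MeasurableSpace Ω] (μ : Measure Ω) (p : ℝ) {m : ℕ}
    (Y : Ω → Word m) : Prop :=
  (∀ x : Cube m, Measurable fun ω => Y ω x) ∧
    iIndepFun (fun (x : Cube m) (ω : Ω) => Y ω x) μ ∧
    ∀ x : Cube m, μ.real {ω | Y ω x = 1} = p

end RPA

/-! Suppose every child estimate is zero. A line through `x` then disagrees exactly when its other
point carries a different value, so at `x` the votes count the points with value different from `y
x`. If fewer than half of the coordinates are ones, majority voting clears the word in one round,
and zero is a fixed point (`aggregate_zero`, `decode_eq_zero`). Hence a node fails only if some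
child fails or at least half of its word is in error.

A projection adds disjoint pairs of independent bits, so each node sees a Bernoulli word with
parameter `pLevel` (`IsBernoulliWord.projectWord`), and Hoeffding bounds the second event. At the
leaves, a nonzero affine function has weight at least half the length. A maximum-likelihood error
requires ones on at least half of such a support; Hoeffding and a union bound apply again
(`real_firstOrder_ne_zero`).

The recursion `fail ≤ (N - 1) * fail_child + e`, with `N` the length at the node and `e` the common
exponential, yields at most `N ^ s * e` for order `s ≥ 2` (`real_decode_ne_zero`). A last union
bound over the lines at level `j` concludes. -/

/-- If the random variables `X i j` are independent as a family indexed by the pairs `(i, j)`, then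
the random functions `X i` are independent. -/
lemma ProbabilityTheory.iIndepFun.curry {ι κ Ω E : Type*} {mΩ : MeasurableSpace Ω}
    {P : Measure Ω} [IsProbabilityMeasure P] [MeasurableSpace E] {X : ι → κ → Ω → E}
    (mX : ∀ i j, Measurable (X i j)) (h : iIndepFun (fun (p : ι × κ) ω => X p.1 p.2 ω) P) :
    iIndepFun (fun i ω j => X i j ω) P := by
  have (i : ι) (j : κ) : IsProbabilityMeasure (P.map (X i j)) :=
    Measure.isProbabilityMeasure_map (mX i j).aemeasurable
  have hrow (i : ι) : iIndepFun (X i) P :=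
    h.precomp (g := fun j : κ => (i, j)) (fun a b hab => congrArg Prod.snd hab)
  rw [iIndepFun_iff_map_fun_eq_infinitePi_map (by fun_prop)]
  simp_rw [fun i => (iIndepFun_iff_map_fun_eq_infinitePi_map (mX i)).1 (hrow i)]
  rw [← Measure.infinitePi_map_curry (fun i j => P.map (X i j)),
    ← (iIndepFun_iff_map_fun_eq_infinitePi_map (fun p : ι × κ => mX p.1 p.2)).1 h,
    Measure.map_map (by fun_prop) (by fun_prop)]
  rfl

/-! ### Bernoulli words and Hoeffding's inequality -/

namespace RPA

lemma ZMod.two_eq_zero_or_one (a : ZMod 2) : a = 0 ∨ a = 1 := by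
  revert a; decide

variable {Ω : Type*} [MeasurableSpace Ω] {μ : Measure Ω} {n : ℕ} {q : ℝ} {Z : Ω → Word n}

lemma IsBernoulliWord.measurable (hZ : IsBernoulliWord μ q Z) : Measurable Z :=
  measurable_pi_iff.2 hZ.1

lemma IsBernoulliWord.measurableSet (hZ : IsBernoulliWord μ q Z) (A : Set (Word n)) :
    MeasurableSet {ω | Z ω ∈ A} :=
  hZ.measurable A.toFinite.measurableSet

variable [IsProbabilityMeasure μ]

lemma IsBernoulliWord.real_eq_zero (hZ : IsBernoulliWord μ q Z) (x : Cube n) :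
    μ.real {ω | Z ω x = 0} = 1 - q := by
  have h : {ω | Z ω x = 0} = {ω | Z ω x = 1}ᶜ := by
    ext ω
    rcases ZMod.two_eq_zero_or_one (Z ω x) with h | h <;> simp [h]
  have hms : MeasurableSet {ω | Z ω x = 1} := hZ.1 x (measurableSet_singleton 1)
  rw [h, probReal_compl_eq_one_sub hms, hZ.2.2 x]

lemma IsBernoulliWord.real_add_eq_one (hZ : IsBernoulliWord μ q Z) {x y : Cube n} (hxy : x ≠ y) :
    μ.real {ω | Z ω x + Z ω y = 1} = 2 * q * (1 - q) := by
  have hind : IndepFun (fun ω => Z ω x) (fun ω => Z ω y) μ := hZ.2.1.indepFun hxy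
  have hprod (a b : ZMod 2) : μ.real {ω | Z ω x = a ∧ Z ω y = b} =
      μ.real {ω | Z ω x = a} * μ.real {ω | Z ω y = b} := by
    have := hind.measure_inter_preimage_eq_mul {a} {b} (measurableSet_singleton a)
      (measurableSet_singleton b)
    rw [measureReal_def, measureReal_def, measureReal_def, ← ENNReal.toReal_mul]
    exact congrArg ENNReal.toReal this
  have hset : {ω | Z ω x + Z ω y = 1} =
      {ω | Z ω x = 1 ∧ Z ω y = 0} ∪ {ω | Z ω x = 0 ∧ Z ω y = 1} := by
    ext ω
    simp only [Set.mem_ofPred_eq, Set.mem_union]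
    generalize Z ω x = a
    generalize Z ω y = b
    revert a b
    decide
  rw [hset, measureReal_union, hprod, hprod, hZ.real_eq_zero, hZ.real_eq_zero, hZ.2.2, hZ.2.2]
  · ring
  · rw [Set.disjoint_left]
    rintro ω ⟨h1, -⟩ ⟨h2, -⟩
    simp [h1] at h2
  · exact (hZ.1 x (measurableSet_singleton 0)).inter (hZ.1 y (measurableSet_singleton 1))

/-- Sums of the coordinates of a Bernoulli word over disjoint pairs form a Bernoulli word. -/
lemma IsBernoulliWord.pairSum (hZ : IsBernoulliWord μ q Z) {k : ℕ} (f : Cube k × Fin 2 → Cube n)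
    (hf : Function.Injective f) :
    IsBernoulliWord μ (2 * q * (1 - q)) (fun ω z => Z ω (f (z, 0)) + Z ω (f (z, 1))) := by
  refine ⟨fun x => (hZ.1 _).add (hZ.1 _), ?_, fun x => hZ.real_add_eq_one fun h => ?_⟩
  · have h := iIndepFun.curry (X := fun z i ω => Z ω (f (z, i))) (fun _ _ => hZ.1 _)
      (hZ.2.1.precomp hf)
    exact h.comp (fun _ v => v 0 + v 1) fun _ => by fun_prop
  · simpa using hf h

/-- Hoeffding's inequality for the number of ones that a Bernoulli word has on `S`. -/
lemma IsBernoulliWord.real_half_le_ones (hZ : IsBernoulliWord μ q Z) (S : Finset (Cube n)) {t : ℝ}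
    (ht0 : 0 ≤ t) (ht : t ≤ 1 / 2 - q) :
    μ.real {ω | S.card ≤ 2 * (S.filter fun x => Z ω x = 1).card} ≤
      Real.exp (-(2 * S.card * t ^ 2)) := by
  let g : ZMod 2 → ℝ := fun v => if v = 1 then 1 else 0
  have hg : Measurable g := measurable_of_countable g
  have hmean (x : Cube n) : μ[fun ω => g (Z ω x)] = q := by
    have hms : MeasurableSet {ω | Z ω x = 1} := hZ.1 x (measurableSet_singleton 1)
    have : (fun ω => g (Z ω x)) = {ω | Z ω x = 1}.indicator 1 := by
      ext ω
      simp [g, Set.indicator_apply]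
    rw [this, integral_indicator_one hms, hZ.2.2 x]
  have hsub (x : Cube n) : HasSubgaussianMGF (fun ω => g (Z ω x) - q) ((‖(1 : ℝ) - 0‖₊ / 2) ^ 2) μ := by
    rw [← hmean x]
    refine hasSubgaussianMGF_of_mem_Icc (hg.comp (hZ.1 x)).aemeasurable (.of_forall fun ω => ?_)
    simp only [g]
    split_ifs <;> simp
  have hind : iIndepFun (fun (x : Cube n) ω => g (Z ω x) - q) μ :=
    hZ.2.1.comp (fun _ v => g v - q) fun _ => measurable_of_countable _
  -- Ones on half of `S` push the centred sum up to `S.card * (1 / 2 - q)`. Each term has variance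
  -- proxy 1/4, which gives the exponent `-2 * S.card * (1 / 2 - q) ^ 2`.
  have hbound := HasSubgaussianMGF.measure_sum_ge_le_of_iIndepFun hind (s := S) (fun x _ => hsub x)
    (ε := S.card * (1 / 2 - q)) (by nlinarith [(Nat.cast_nonneg S.card : (0 : ℝ) ≤ S.card)])
  refine (measureReal_mono fun ω hω => ?_).trans (hbound.trans (Real.exp_le_exp.2 ?_))
  · simp only [Set.mem_ofPred_eq, Finset.sum_sub_distrib, g, Finset.sum_boole, Finset.sum_const,
      nsmul_eq_mul] at hω ⊢
    have : (S.card : ℝ) ≤ 2 * (S.filter fun x => Z ω x = 1).card := by exact_mod_cast hω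
    linarith
  · rcases S.card.eq_zero_or_pos with h0 | hpos
    · simp [h0]
    · have hpos' : (0 : ℝ) < S.card := by exact_mod_cast hpos
      have hsq : t ^ 2 ≤ (1 / 2 - q) ^ 2 := pow_le_pow_left₀ ht0 ht 2
      simp only [sub_zero, nnnorm_one, Finset.sum_const, NNReal.coe_pow, NNReal.coe_div,
        NNReal.coe_one, NNReal.coe_ofNat, nsmul_eq_mul, NNReal.coe_mul, NNReal.coe_natCast]
      rw [neg_div, neg_le_neg_iff, le_div_iff₀ (by positivity)]
      nlinarith [mul_le_mul_of_nonneg_left hsq (sq_nonneg (S.card : ℝ))]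

/-! ### Crossover probabilities along the tree -/

lemma pLevel_zero (p : ℝ) : pLevel p 0 = p := by
  simp [pLevel]

/-- The bias `1 - 2p` is squared at each level, so composing levels adds indices. -/
lemma one_sub_two_mul_pLevel (p : ℝ) (i : ℕ) : 1 - 2 * pLevel p i = (1 - 2 * p) ^ 2 ^ i := by
  simp only [pLevel]; ring

lemma pLevel_one (p : ℝ) : pLevel p 1 = 2 * p * (1 - p) := by
  simp only [pLevel]; ring

lemma pLevel_pLevel (p : ℝ) (i k : ℕ) : pLevel (pLevel p i) k = pLevel p (i + k) := by
  rw [pLevel, one_sub_two_mul_pLevel, ← pow_mul, ← pow_add, pLevel]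

lemma pLevel_mem_Icc {p : ℝ} (hp0 : 0 ≤ p) (hp1 : p ≤ 1 / 2) (i : ℕ) :
    0 ≤ pLevel p i ∧ pLevel p i ≤ 1 / 2 := by
  have h := one_sub_two_mul_pLevel p i
  have h1 : 0 ≤ (1 - 2 * p) ^ 2 ^ i := pow_nonneg (by linarith) _
  have h2 : (1 - 2 * p) ^ 2 ^ i ≤ 1 := pow_le_one₀ (by linarith) (by linarith)
  constructor <;> linarith

/-- `eta` is the Hoeffding margin one level further down: `eta` at level `r - 2` is the margin at
the first-order leaves. -/
lemma eta_eq (q : ℝ) : eta q = 1 / 2 - pLevel q 1 := by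
  rw [pLevel_one, eta]; ring

/-- Noise grows down the tree, so the margin available at the leaves is also available at every node
above. -/
lemma eta_pLevel_le {q : ℝ} (hq0 : 0 ≤ q) (hq1 : q ≤ 1 / 2) (i : ℕ) :
    eta (pLevel q i) ≤ 1 / 2 - q := by
  have h := one_sub_two_mul_pLevel q (i + 1)
  have h2 : (1 - 2 * q) ^ 2 ^ (i + 1) ≤ (1 - 2 * q) ^ 1 :=
    pow_le_pow_of_le_one (by linarith) (by linarith) Nat.one_le_two_pow
  rw [eta_eq, pLevel_pLevel]
  linarith

end RPA

/-! ### Lines, votes and aggregation -/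

namespace RPA

variable {n : ℕ}

/-- The number of ones of a word. -/
def weight (y : Word n) : ℕ := (Finset.univ.filter fun x => y x = 1).card

lemma ZMod.two_ne_zero_iff (a : ZMod 2) : a ≠ 0 ↔ a = 1 := by
  revert a; decide

lemma card_cube (n : ℕ) : Fintype.card (Cube n) = 2 ^ n := by
  simp [ZMod.card]

lemma mem_span_singleton_iff (v w : Cube n) :
    w ∈ Submodule.span (ZMod 2) {v} ↔ w = 0 ∨ w = v := by
  rw [Submodule.mem_span_singleton]
  constructor
  · rintro ⟨a, rfl⟩
    rcases ZMod.two_eq_zero_or_one a with rfl | rfl <;> simp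
  · rintro (rfl | rfl)
    · exact ⟨0, by simp⟩
    · exact ⟨1, by simp⟩

/-- The line spanned by a nonzero vector. -/
def lineOf (v : {v : Cube n // v ≠ 0}) : Line n :=
  ⟨Submodule.span (ZMod 2) {v.1}, finrank_span_singleton v.2⟩

/-- Over the field with two elements a line has exactly one nonzero vector, so lines can be replaced
by nonzero shifts. -/
lemma lineOf_bijective : Function.Bijective (lineOf (n := n)) := by
  constructor
  · intro v w h
    have hv : v.1 ∈ Submodule.span (ZMod 2) {w.1} := by
      have h' : Submodule.span (ZMod 2) {v.1} = Submodule.span (ZMod 2) {w.1} :=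
        congrArg Subtype.val h
      exact h' ▸ Submodule.mem_span_singleton_self v.1
    exact Subtype.ext (((mem_span_singleton_iff _ _).1 hv).resolve_left v.2)
  · rintro ⟨B, hB⟩
    obtain ⟨v, hv, h⟩ := finrank_eq_one_iff'.1 hB
    refine ⟨⟨v.1, fun h0 => hv (Subtype.ext h0)⟩, Subtype.ext (le_antisymm ?_ fun w hw => ?_)⟩
    · exact (Submodule.span_singleton_le_iff_mem _ _).2 v.2
    · obtain ⟨c, hc⟩ := h ⟨w, hw⟩
      exact Submodule.mem_span_singleton.2 ⟨c, congrArg Subtype.val hc⟩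

lemma card_line (n : ℕ) : Nat.card (Line n) = 2 ^ n - 1 := by
  rw [← Nat.card_eq_of_bijective _ (lineOf_bijective (n := n)), Nat.card_eq_fintype_card,
    Fintype.card_subtype_compl, card_cube, Fintype.card_subtype_eq]

instance : Finite (Line n) :=
  Finite.of_surjective _ lineOf_bijective.surjective

lemma mk_eq_mk_iff (v : {v : Cube n // v ≠ 0}) (x x' : Cube n) :
    (Submodule.Quotient.mk x' : Cube n ⧸ (lineOf v).1) = Submodule.Quotient.mk x ↔
      x' = x ∨ x' = x + v.1 := by
  rw [Submodule.Quotient.eq]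
  change x' - x ∈ Submodule.span (ZMod 2) {v.1} ↔ _
  rw [mem_span_singleton_iff, sub_eq_zero, sub_eq_iff_eq_add']

lemma project_lineOf (v : {v : Cube n // v ≠ 0}) (y : Word n) (x : Cube n) :
    project (lineOf v) y (Submodule.Quotient.mk x) = y x + y (x + v.1) := by
  classical
  have h : (Finset.univ.filter fun x' : Cube n =>
      (Submodule.Quotient.mk x' : Cube n ⧸ (lineOf v).1) = Submodule.Quotient.mk x) =
      {x, x + v.1} := by
    ext x'
    simp [mk_eq_mk_iff]
  rw [project, h, Finset.sum_pair]
  simpa using v.2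

lemma projectWord_zero (σ : CosetOrdering) (B : Line (n + 1)) : projectWord σ B 0 = 0 := by
  ext z
  simp [projectWord, project]

/-- With all estimates zero, the lines that disagree at `x` are those joining `x` to a point at
which the word has a different value. -/
lemma disagreements_zero (σ : CosetOrdering) (y : Word (n + 1)) (x : Cube (n + 1)) :
    disagreements σ y (fun _ => 0) x = (Finset.univ.filter fun x' => y x' ≠ y x).card := by
  classical
  have h : {B : Line (n + 1) | projectWord σ B y (σ n B (Submodule.Quotient.mk x)) ≠
      (0 : Word n) (σ n B (Submodule.Quotient.mk x))} =
      lineOf '' {v | y (x + v.1) ≠ y x} := by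
    ext B
    obtain ⟨v, rfl⟩ := lineOf_bijective.surjective B
    rw [Function.Injective.mem_set_image lineOf_bijective.injective]
    simp only [Set.mem_ofPred_eq, projectWord, Equiv.symm_apply_apply, project_lineOf, Pi.zero_apply]
    rw [not_iff_not, CharTwo.add_eq_zero, eq_comm]
  rw [disagreements, h, Set.ncard_image_of_injective _ lineOf_bijective.injective,
    ← Set.ncard_coe_finset]
  refine Set.ncard_congr (fun v _ => x + v.1) (fun v hv => by simpa using hv)
    (fun v w _ _ hvw => Subtype.ext (add_left_cancel hvw)) fun x' hx' => ?_
  have hx : y x' ≠ y x := by simpa using hx'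
  refine ⟨⟨x' - x, fun h0 => hx (by rw [sub_eq_zero.1 h0])⟩, ?_, by simp⟩
  simpa using hx

lemma aggregate_zero (σ : CosetOrdering) (y : Word (n + 1)) (hy : 2 * weight y < 2 ^ (n + 1)) :
    aggregate σ y (fun _ => 0) = 0 := by
  ext x
  have hpos : 1 ≤ 2 ^ (n + 1) := Nat.one_le_two_pow
  have hcast : (Nat.card (Line (n + 1)) : ℝ) = (2 : ℝ) ^ (n + 1) - 1 := by
    rw [card_line, Nat.cast_sub hpos]; simp
  -- By integrality the weight is at most half the number `2 ^ (n + 1) - 1` of lines, so the strict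
  -- vote threshold is not exceeded where `y` is zero.
  have hyR : 2 * (weight y : ℝ) + 1 ≤ (2 : ℝ) ^ (n + 1) := by exact_mod_cast hy
  simp only [aggregate, flipVector, Pi.add_apply, disagreements_zero, hcast, Pi.zero_apply]
  rcases ZMod.two_eq_zero_or_one (y x) with hx | hx
  · rw [if_neg]
    · simp [hx]
    · simp only [hx, ZMod.two_ne_zero_iff]
      change ¬ _ < (weight y : ℝ)
      linarith
  · rw [if_pos]
    · rw [hx]; decide
    · have hsum : (Finset.univ.filter fun x' => y x' = 1).card +
          (Finset.univ.filter fun x' => y x' ≠ 1).card = 2 ^ (n + 1) := by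
        rw [Finset.card_filter_add_card_filter_not, Finset.card_univ, card_cube]
      have hsumR : (weight y : ℝ) + ((Finset.univ.filter fun x' => y x' ≠ 1).card : ℝ) =
          (2 : ℝ) ^ (n + 1) := by exact_mod_cast hsum
      simp only [hx]
      linarith

lemma zero_mem_reedMuller (n s : ℕ) : (0 : Word n) ∈ reedMuller n s :=
  ⟨0, by simp, by simp⟩

lemma IsFirstOrderML.apply_zero {D : ∀ n : ℕ, Word n → Word n} (hD : IsFirstOrderML D) (n : ℕ) :
    D n 0 = 0 := by
  have h := (hD n 0).2 0 (zero_mem_reedMuller n 1)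
  rw [hammingDist_self, Nat.le_zero, hammingDist_eq_zero] at h
  exact h.symm

lemma iterateUntilFixed_eq {α : Type} {step : α → α} {z : α} (hz : step z = z) (M : ℕ) :
    iterateUntilFixed step M z = z := by
  cases M with
  | zero => rfl
  | succ M => simp [iterateUntilFixed, hz]

lemma iterateUntilFixed_succ_eq {α : Type} {step : α → α} {y z : α} (hy : step y = z)
    (hz : step z = z) (M : ℕ) : iterateUntilFixed step (M + 1) y = z := by
  rw [iterateUntilFixed]
  split_ifs with h
  · rw [h, hy]
  · rw [hy, iterateUntilFixed_eq hz]

/-! ### When the decoder returns zero -/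

section decode

variable (σ : CosetOrdering) {D : ∀ n : ℕ, Word n → Word n}

lemma decode_zero (hD : IsFirstOrderML D) (M s n : ℕ) : decode σ D M s n 0 = 0 := by
  induction s generalizing n with
  | zero => rw [decode]
  | succ s ih =>
    cases s with
    | zero => rw [decode, hD.apply_zero]
    | succ s =>
      cases n with
      | zero => rw [decode]
      | succ n =>
        rw [decode]
        refine iterateUntilFixed_eq ?_ M
        simp only [projectWord_zero, ih]
        exact aggregate_zero σ 0 (by simp [weight])

/-- The decoder returns zero as soon as all its children do and the word has few ones. -/
lemma decode_eq_zero (hD : IsFirstOrderML D) {M : ℕ} (hM : 1 ≤ M) (s : ℕ) (y : Word (n + 1))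
    (hy : 2 * weight y < 2 ^ (n + 1))
    (hchild : ∀ B : Line (n + 1), decode σ D M (s + 1) n (projectWord σ B y) = 0) :
    decode σ D M (s + 2) (n + 1) y = 0 := by
  -- One round suffices: it reaches zero, which all later rounds fix.
  obtain ⟨M, rfl⟩ := Nat.exists_eq_add_of_le' hM
  rw [decode]
  refine iterateUntilFixed_succ_eq ?_ ?_ M
  · simp only [hchild]
    exact aggregate_zero σ y hy
  · simp only [projectWord_zero, decode_zero σ hD]
    exact aggregate_zero σ 0 (by simp [weight])

end decode

/-! ### Codewords of first-order codes -/

/-- The evaluation vector of the affine function with constant term `c.1` and linear part `c.2`. -/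
def affineWord (c : ZMod 2 × Cube n) : Word n := fun z => c.1 + ∑ i, c.2 i * z i

lemma affineWord_zero : affineWord (0 : ZMod 2 × Cube n) = 0 := by
  ext z
  simp [affineWord]

lemma exists_affineWord_of_mem_reedMuller {c : Word n} (hc : c ∈ reedMuller n 1) :
    ∃ a, c = affineWord a := by
  obtain ⟨f, hf, hcf⟩ := hc
  suffices h : ∃ a : ZMod 2 × Cube n, ∀ z, MvPolynomial.eval z f = affineWord a z by
    obtain ⟨a, ha⟩ := h
    exact ⟨a, funext fun z => (hcf z).trans (ha z)⟩
  -- A monomial of degree at most one is constant or a single variable.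
  have hmon (d : Fin n →₀ ℕ) (hd : d ∈ f.support) (z : Cube n) :
      f.coeff d * ∏ i, z i ^ d i =
        (if d = 0 then f.coeff d else 0) +
          ∑ i, (if d = Finsupp.single i 1 then f.coeff d else 0) * z i := by
    have hdeg : d.degree ≤ 1 := (MvPolynomial.le_totalDegree hd).trans hf
    rcases Nat.le_one_iff_eq_zero_or_eq_one.1 hdeg with h | h
    · have h0 : d = 0 := (Finsupp.degree_eq_zero_iff d).1 h
      subst h0
      have (i : Fin n) : (0 : Fin n →₀ ℕ) ≠ Finsupp.single i 1 := by simp [eq_comm]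
      simp [this]
    · obtain ⟨i, rfl⟩ := (Finsupp.sum_eq_one_iff d).1 h
      have (k : Fin n) : (Finsupp.single i 1 : Fin n →₀ ℕ) = Finsupp.single k 1 ↔ i = k :=
        Finsupp.single_left_inj one_ne_zero
      simp only [this, Finsupp.single_eq_zero, one_ne_zero, if_false, zero_add, ite_mul, zero_mul,
        Finset.sum_ite_eq, Finset.mem_univ, if_true]
      rw [Finset.prod_eq_single i (fun k _ hk => by simp [hk.symm])
        (by simp)]
      simp
  refine ⟨(∑ d ∈ f.support, if d = 0 then f.coeff d else 0,
    fun i => ∑ d ∈ f.support, if d = Finsupp.single i 1 then f.coeff d else 0), fun z => ?_⟩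
  rw [MvPolynomial.eval_eq', Finset.sum_congr rfl fun d hd => hmon d hd z, Finset.sum_add_distrib,
    Finset.sum_comm]
  simp only [affineWord, Finset.sum_mul]

/-- A nonzero affine function takes the value one on at least half of the cube. -/
lemma two_pow_le_two_mul_weight_affineWord {a : ZMod 2 × Cube n} (ha : a ≠ 0) :
    2 ^ n ≤ 2 * weight (affineWord a) := by
  classical
  have hsum : (Finset.univ.filter fun z => affineWord a z = 1).card +
      (Finset.univ.filter fun z => affineWord a z ≠ 1).card = 2 ^ n := by
    rw [Finset.card_filter_add_card_filter_not, Finset.card_univ, card_cube]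
  have hle : (Finset.univ.filter fun z => affineWord a z ≠ 1).card ≤
      (Finset.univ.filter fun z => affineWord a z = 1).card := by
    by_cases hb : a.2 = 0
    · have h1 : a.1 = 1 := (ZMod.two_eq_zero_or_one a.1).resolve_left fun h => ha (Prod.ext h hb)
      have : (Finset.univ.filter fun z => affineWord a z ≠ 1) = ∅ := by
        simp [affineWord, hb, h1]
      simp [this]
    · obtain ⟨i, hi⟩ := Function.ne_iff.1 hb
      have hi1 : a.2 i = 1 := (ZMod.two_eq_zero_or_one _).resolve_left hi
      -- Flipping a coordinate on which the linear part is nonzero injects the zeros into the ones.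
      have hshift (z : Cube n) : affineWord a (z + Pi.single i 1) = affineWord a z + 1 := by
        simp [affineWord, mul_add, Finset.sum_add_distrib, Pi.single_apply, hi1, add_assoc]
      refine Finset.card_le_card_of_injOn (fun z => z + Pi.single i 1) (fun z hz => ?_)
        fun z _ w _ h => add_right_cancel h
      have hz0 : affineWord a z = 0 :=
        (ZMod.two_eq_zero_or_one _).resolve_right (by simpa using hz)
      simp [hshift, hz0]
  simp only [weight]
  omega

/-- If `y` is at least as near to `c` as to zero, then it has ones on at least half of the support
of `c`. -/
lemma weight_le_of_hammingDist_le {y c : Word n} (h : hammingDist y c ≤ hammingDist y 0) :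
    weight c ≤ 2 * ((Finset.univ.filter fun x => c x = 1).filter fun x => y x = 1).card := by
  classical
  -- Summed over `x`, this is `d(y, c) + 2 |c ∧ y| = d(y, 0) + |c|`.
  have hpt (x : Cube n) : (if y x ≠ c x then 1 else 0) + 2 * (if c x = 1 ∧ y x = 1 then 1 else 0) =
      (if y x ≠ 0 then 1 else 0) + (if c x = 1 then 1 else 0) := by
    generalize y x = a
    generalize c x = b
    revert a b
    decide
  have hsum := Finset.sum_congr (rfl : (Finset.univ : Finset (Cube n)) = Finset.univ)
    fun x _ => hpt x
  simp only [Finset.sum_add_distrib, ← Finset.mul_sum, Finset.sum_boole, Nat.cast_id] at hsum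
  rw [Finset.filter_filter]
  simp only [hammingDist, Pi.zero_apply] at h
  simp only [weight]
  omega

end RPA

/-! ### Failure probabilities down the tree -/

namespace RPA

variable {Ω : Type*} [MeasurableSpace Ω] {μ : Measure Ω}
  {n : ℕ} {q : ℝ}

/-- Union bound over the lines. -/
lemma real_exists_line_le {b : ℝ} (E : Line n → Set Ω) (hE : ∀ B, μ.real (E B) ≤ b) :
    μ.real {ω | ∃ B, ω ∈ E B} ≤ (2 ^ n - 1) * b := by
  have := Fintype.ofFinite (Line n)
  have hset : {ω | ∃ B, ω ∈ E B} = ⋃ B, E B := by ext; simp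
  have hcard : (Fintype.card (Line n) : ℝ) = 2 ^ n - 1 := by
    rw [← Nat.card_eq_fintype_card, card_line, Nat.cast_sub Nat.one_le_two_pow]
    simp
  rw [hset]
  refine (measureReal_iUnion_fintype_le E).trans ((Finset.sum_le_sum fun B _ => hE B).trans ?_)
  rw [Finset.sum_const, nsmul_eq_mul, Finset.card_univ, hcard]

variable [IsProbabilityMeasure μ]

/-- A projection of a Bernoulli word is a Bernoulli word. -/
lemma IsBernoulliWord.projectWord {Z : Ω → Word (n + 1)} (hZ : IsBernoulliWord μ q Z)
    (σ : CosetOrdering) (B : Line (n + 1)) :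
    IsBernoulliWord μ (pLevel q 1) (fun ω => RPA.projectWord σ B (Z ω)) := by
  obtain ⟨v, rfl⟩ := lineOf_bijective.surjective B
  let a : Cube n → Cube (n + 1) := fun z => ((σ n (lineOf v)).symm z).out
  have ha (z : Cube n) : (Submodule.Quotient.mk (a z) : Cube (n + 1) ⧸ (lineOf v).1) =
      (σ n (lineOf v)).symm z := Quotient.out_eq _
  have ha' (z : Cube n) (w : Cube (n + 1)) (hw : w = a z ∨ w = a z + v.1) :
      σ n (lineOf v) (Submodule.Quotient.mk w) = z := by
    rw [(mk_eq_mk_iff v (a z) w).2 hw, ha, Equiv.apply_symm_apply]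
  -- `f` lists the two points of each coset: the chosen representative and its shift by `v`.
  let f : Cube n × Fin 2 → Cube (n + 1) := fun c => if c.2 = 0 then a c.1 else a c.1 + v.1
  have hf : Function.Injective f := by
    intro c d hcd
    have hfc (c : Cube n × Fin 2) : f c = a c.1 ∨ f c = a c.1 + v.1 := by
      simp only [f]; split_ifs <;> simp
    have h1 : c.1 = d.1 := by
      rw [← ha' c.1 (f c) (hfc c), ← ha' d.1 (f d) (hfc d), hcd]
    refine Prod.ext h1 ?_
    have hv : v.1 ≠ 0 := v.2
    obtain ⟨z, i⟩ := c
    obtain ⟨w, k⟩ := d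
    obtain rfl : z = w := h1
    fin_cases i <;> fin_cases k <;> simp_all [f]
  rw [pLevel_one]
  convert! hZ.pairSum f hf using 3 with ω z
  rw [RPA.projectWord, ← ha, project_lineOf]
  simp [f]

/-- The bound `n ≤ m` is carried through the induction to keep the truncated subtraction `m - n` an
honest level. -/
lemma IsBernoulliWord.projectAlong {m : ℕ} {p : ℝ} {Y : Ω → Word m} (hY : IsBernoulliWord μ p Y)
    (σ : CosetOrdering) {n : ℕ} (P : Path m n) :
    n ≤ m ∧ IsBernoulliWord μ (pLevel p (m - n)) (fun ω => RPA.projectAlong σ P (Y ω)) := by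
  induction P with
  | root =>
    refine ⟨le_rfl, ?_⟩
    simpa only [Nat.sub_self, pLevel_zero, RPA.projectAlong] using hY
  | @snoc n P S ih =>
    obtain ⟨hn, h⟩ := ih
    refine ⟨by omega, ?_⟩
    have h' := h.projectWord σ S
    rw [pLevel_pLevel, show m - (n + 1) + 1 = m - n by omega] at h'
    exact h'

/-- The probability that maximum likelihood decoding of a first-order code fails. -/
lemma IsBernoulliWord.real_firstOrder_ne_zero {D : ∀ n : ℕ, Word n → Word n}
    (hD : IsFirstOrderML D) {Z : Ω → Word n} (hZ : IsBernoulliWord μ q Z) {t : ℝ} (ht0 : 0 ≤ t)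
    (ht : t ≤ 1 / 2 - q) :
    μ.real {ω | D n (Z ω) ≠ 0} ≤ (2 ^ (n + 1) - 1) * Real.exp (-(2 ^ n * t ^ 2)) := by
  classical
  let supp : ZMod 2 × Cube n → Finset (Cube n) :=
    fun a => Finset.univ.filter fun x => affineWord a x = 1
  have hcard : ((Finset.univ.filter fun a : ZMod 2 × Cube n => a ≠ 0).card : ℝ) =
      2 ^ (n + 1) - 1 := by
    rw [Finset.filter_ne', Finset.card_erase_of_mem (Finset.mem_univ _), Finset.card_univ,
      Fintype.card_prod, card_cube, ZMod.card, ← pow_succ', Nat.cast_sub Nat.one_le_two_pow]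
    simp
  have hsub : {ω | D n (Z ω) ≠ 0} ⊆ ⋃ a ∈ Finset.univ.filter fun a : ZMod 2 × Cube n => a ≠ 0,
      {ω | (supp a).card ≤ 2 * ((supp a).filter fun x => Z ω x = 1).card} := by
    intro ω hω
    obtain ⟨a, ha⟩ := exists_affineWord_of_mem_reedMuller (hD n (Z ω)).1
    have hle := (hD n (Z ω)).2 0 (zero_mem_reedMuller n 1)
    rw [ha] at hle
    have ha0 : a ≠ 0 := by
      rintro rfl
      exact hω (ha.trans affineWord_zero)
    simp only [Set.mem_iUnion]
    exact ⟨a, by simpa using ha0, weight_le_of_hammingDist_le hle⟩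
  calc μ.real {ω | D n (Z ω) ≠ 0}
      ≤ ∑ a ∈ Finset.univ.filter fun a : ZMod 2 × Cube n => a ≠ 0,
        μ.real {ω | (supp a).card ≤ 2 * ((supp a).filter fun x => Z ω x = 1).card} :=
        (measureReal_mono hsub (measure_ne_top _ _)).trans (measureReal_biUnion_finset_le _ _)
    _ ≤ ∑ a ∈ Finset.univ.filter fun a : ZMod 2 × Cube n => a ≠ 0,
        Real.exp (-(2 ^ n * t ^ 2)) := by
        refine Finset.sum_le_sum fun a ha => (hZ.real_half_le_ones (supp a) ht0 ht).trans ?_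
        have hw : (2 : ℝ) ^ n ≤ 2 * (supp a).card := by
          exact_mod_cast two_pow_le_two_mul_weight_affineWord (Finset.mem_filter.1 ha).2
        exact Real.exp_le_exp.2 (neg_le_neg (mul_le_mul_of_nonneg_right hw (sq_nonneg t)))
    _ = _ := by rw [Finset.sum_const, nsmul_eq_mul, hcard]

/-- One level of the recursion: the decoder fails only if a child fails or half of the received
word is in error. -/
lemma IsBernoulliWord.real_decode_ne_zero_le (σ : CosetOrdering) {D : ∀ n : ℕ, Word n → Word n}
    (hD : IsFirstOrderML D) {M : ℕ} (hM : 1 ≤ M) (s : ℕ) {Z : Ω → Word (n + 1)}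
    (hZ : IsBernoulliWord μ q Z) {t b : ℝ} (ht0 : 0 ≤ t) (ht : t ≤ 1 / 2 - q)
    (hb : ∀ B : Line (n + 1),
      μ.real {ω | decode σ D M (s + 1) n (RPA.projectWord σ B (Z ω)) ≠ 0} ≤ b) :
    μ.real {ω | decode σ D M (s + 2) (n + 1) (Z ω) ≠ 0} ≤
      (2 ^ (n + 1) - 1) * b + Real.exp (-(2 * 2 ^ (n + 1) * t ^ 2)) := by
  have hw := hZ.real_half_le_ones Finset.univ ht0 ht
  rw [Finset.card_univ, card_cube, Nat.cast_pow, Nat.cast_ofNat] at hw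
  refine le_trans (measureReal_mono ?_) ((measureReal_union_le _ _).trans
    (add_le_add (real_exists_line_le _ hb) hw))
  intro ω hω
  by_contra hcon
  simp only [Set.mem_union, Set.mem_ofPred_eq, not_or, not_exists, not_not, not_le] at hcon
  exact hω (decode_eq_zero σ hD hM s (Z ω) hcon.2 hcon.1)

/-- The failure probability of the decoder for a code of order `s + 2` and length
`2 ^ (n + 1 + s)`. -/
lemma IsBernoulliWord.real_decode_ne_zero (σ : CosetOrdering) {D : ∀ n : ℕ, Word n → Word n}
    (hD : IsFirstOrderML D) {M : ℕ} (hM : 1 ≤ M) {ε : ℝ} (hε0 : 0 ≤ ε) (s : ℕ) {q : ℝ}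
    {Z : Ω → Word (n + 1 + s)} (hZ : IsBernoulliWord μ q Z) (hq0 : 0 ≤ q) (hq1 : q ≤ 1 / 2)
    (hε : ε ≤ eta (pLevel q s)) :
    μ.real {ω | decode σ D M (s + 2) (n + 1 + s) (Z ω) ≠ 0} ≤
      (2 ^ (n + 1 + s)) ^ (s + 2) * Real.exp (-(2 ^ (n + 1) * ε ^ 2 / 8)) := by
  -- The exponent is fixed by `n + 1`, the dimension at the order-two nodes, so the same `e` serves
  -- at every level.
  set e := Real.exp (-(2 ^ (n + 1) * ε ^ 2 / 8)) with he
  have he0 : 0 ≤ e := (Real.exp_pos _).le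
  induction s generalizing q with
  | zero =>
    have hchild (B : Line (n + 1)) :
        μ.real {ω | decode σ D M 1 n (RPA.projectWord σ B (Z ω)) ≠ 0} ≤ (2 ^ (n + 1) - 1) * e := by
      have h := (hZ.projectWord σ B).real_firstOrder_ne_zero hD hε0 (by
        rwa [pLevel_zero, eta_eq] at hε)
      simp only [decode]
      refine h.trans (mul_le_mul_of_nonneg_left (Real.exp_le_exp.2 ?_) ?_)
      -- The leaf exponent `2 ^ n * ε ^ 2` is four times the required `2 ^ (n + 1) * ε ^ 2 / 8`.
      · rw [pow_succ (2 : ℝ) n]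
        nlinarith [mul_nonneg (pow_nonneg zero_le_two n : (0 : ℝ) ≤ 2 ^ n) (sq_nonneg ε)]
      · linarith [one_le_pow₀ (one_le_two : (1 : ℝ) ≤ 2) (n := n + 1)]
    have h := hZ.real_decode_ne_zero_le σ hD hM 0 hε0 (hε.trans (eta_pLevel_le hq0 hq1 0)) hchild
    have hexp : Real.exp (-(2 * 2 ^ (n + 1) * ε ^ 2)) ≤ e := Real.exp_le_exp.2 (by
      nlinarith [mul_nonneg (pow_nonneg zero_le_two (n + 1) : (0 : ℝ) ≤ 2 ^ (n + 1)) (sq_nonneg ε)])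
    refine h.trans ?_
    have hN : (1 : ℝ) ≤ 2 ^ (n + 1) := one_le_pow₀ one_le_two
    simp only [add_zero, zero_add]
    nlinarith [mul_nonneg (sub_nonneg.2 hN) he0]
  | succ s ih =>
    have hchild (B : Line (n + 1 + s + 1)) :
        μ.real {ω | decode σ D M (s + 2) (n + 1 + s) (RPA.projectWord σ B (Z ω)) ≠ 0} ≤
          (2 ^ (n + 1 + s)) ^ (s + 2) * e := by
      obtain ⟨h0, h1⟩ := pLevel_mem_Icc hq0 hq1 1
      exact ih (hZ.projectWord σ B) h0 h1 (by rwa [pLevel_pLevel, add_comm])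
    have h := IsBernoulliWord.real_decode_ne_zero_le (n := n + 1 + s) σ hD hM (s + 1) hZ hε0
      (hε.trans (eta_pLevel_le hq0 hq1 _)) hchild
    refine h.trans ?_
    have hN : (1 : ℝ) ≤ 2 ^ (n + 1 + s + 1) := one_le_pow₀ one_le_two
    have hexp : Real.exp (-(2 * 2 ^ (n + 1 + s + 1) * ε ^ 2)) ≤ e := by
      have hpow : (2 : ℝ) ^ (n + 1) ≤ 2 ^ (n + 1 + s + 1) :=
        pow_le_pow_right₀ one_le_two (by omega)
      refine Real.exp_le_exp.2 ?_
      nlinarith [mul_le_mul_of_nonneg_right hpow (sq_nonneg ε),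
        mul_nonneg (pow_nonneg zero_le_two (n + 1) : (0 : ℝ) ≤ 2 ^ (n + 1)) (sq_nonneg ε)]
    have hc : ((2 : ℝ) ^ (n + 1 + s)) ^ (s + 2) ≤ (2 ^ (n + 1 + s + 1)) ^ (s + 2) :=
      pow_le_pow_left₀ (by positivity) (pow_le_pow_right₀ one_le_two (by omega)) _
    have hc1 : (1 : ℝ) ≤ (2 ^ (n + 1 + s + 1)) ^ (s + 2) := one_le_pow₀ hN
    change _ ≤ ((2 : ℝ) ^ (n + 1 + s + 1)) ^ (s + 2 + 1) * e
    rw [pow_succ _ (s + 2)]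
    -- With `N` the length, `c` the child factor, `C = N ^ (s + 2)`, `c ≤ C` and `1 ≤ C`: `(N - 1) *
    -- c + 1 ≤ N * C`. The missing line absorbs the Hoeffding term.
    nlinarith [mul_nonneg (mul_nonneg (sub_nonneg.2 hN) (sub_nonneg.2 hc)) he0,
      mul_nonneg (sub_nonneg.2 hc1) he0]

end RPA

theorem theorem5 {Ω : Type*} [MeasurableSpace Ω] (μ : Measure Ω) [IsProbabilityMeasure μ]
    (m r : ℕ) (hrm : r ≤ m)
    (p : ℝ) (hp0 : 0 < p) (hp1 : p < 1 / 2)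
    (Y : Ω → RPA.Word m) (hY : RPA.IsBernoulliWord μ p Y)
    (σ : RPA.CosetOrdering)
    (D : ∀ n : ℕ, RPA.Word n → RPA.Word n) (hD : RPA.IsFirstOrderML D)
    (M : ℕ) (hM : 1 ≤ M)
    (j : ℕ) (hj1 : 1 ≤ j) (hj2 : j ≤ r - 2)
    (P : RPA.Path m (m - j + 1))
    (ε : ℝ) (hε0 : 0 < ε) (hε : ε < RPA.eta (RPA.pLevel p (r - 2))) :
    1 - 2 ^ (r + 3 - j) * RPA.nLevel m j ^ (r + 2 - j) *
        Real.exp (-(RPA.nLevel m (r - 2) * ε ^ 2 / 8)) ≤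
      μ.real {ω | ∀ S : RPA.Line (m - j + 1),
        RPA.childEstimate σ D M (r - j) P S (Y ω) = 0} := by
  have hlevel (i : ℕ) (hi : i ≤ m) : RPA.nLevel m i = 2 ^ (m - i) := by
    rw [RPA.nLevel, div_eq_iff (by positivity), ← pow_add, Nat.sub_add_cancel hi]
  rw [hlevel j (by omega), hlevel (r - 2) (by omega)]
  -- The dimension `m - j` becomes a variable `i`, so that `n + 1 + s` can be substituted for it
  -- inside the types of paths and lines.
  have hsub (i : ℕ) (hi : m - j = i) (hpath : RPA.Path m (i + 1)) (S : RPA.Line (i + 1)) :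
      μ.real {ω | RPA.childEstimate σ D M (r - j) hpath S (Y ω) ≠ 0} ≤
        (2 ^ i) ^ (r - j) * Real.exp (-(2 ^ (m - (r - 2)) * ε ^ 2 / 8)) := by
    obtain ⟨s, n, hs, hn, hbase⟩ : ∃ s n, r - j = s + 2 ∧ i = n + 1 + s ∧
        m - (r - 2) = n + 1 := ⟨r - j - 2, m - r + 1, by omega, by omega, by omega⟩
    subst hn
    have hZ := (hY.projectAlong σ (hpath.snoc S)).2
    obtain ⟨h0, h1⟩ := RPA.pLevel_mem_Icc hp0.le hp1.le (m - (n + 1 + s))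
    rw [hs, hbase]
    refine hZ.real_decode_ne_zero σ hD hM hε0.le s h0 h1 ?_
    rw [RPA.pLevel_pLevel, show m - (n + 1 + s) + s = r - 2 by omega]
    exact hε.le
  set e := Real.exp (-(2 ^ (m - (r - 2)) * ε ^ 2 / 8))
  have he0 : 0 ≤ e := (Real.exp_pos _).le
  have hfail := RPA.real_exists_line_le _ (hsub (m - j) rfl P)
  have hcompl : {ω | ∃ S : RPA.Line (m - j + 1),
      ω ∈ {ω | RPA.childEstimate σ D M (r - j) P S (Y ω) ≠ 0}} =
      {ω | ∀ S : RPA.Line (m - j + 1), RPA.childEstimate σ D M (r - j) P S (Y ω) = 0}ᶜ := by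
    ext ω
    simp
  have hmeas : MeasurableSet {ω | ∀ S : RPA.Line (m - j + 1),
      RPA.childEstimate σ D M (r - j) P S (Y ω) = 0} :=
    hY.measurableSet {y | ∀ S, RPA.childEstimate σ D M (r - j) P S y = 0}
  rw [hcompl, probReal_compl_eq_one_sub hmeas] at hfail
  have hN : (1 : ℝ) ≤ 2 ^ (m - j) := one_le_pow₀ one_le_two
  -- The union bound already gives the smaller factor `2 * (2 ^ (m - j)) ^ (r - j + 1)`; the stated
  -- one is a relaxation.
  have hbound : ((2 : ℝ) ^ (m - j + 1) - 1) * ((2 ^ (m - j)) ^ (r - j) * e) ≤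
      2 ^ (r + 3 - j) * (2 ^ (m - j)) ^ (r + 2 - j) * e := by
    rw [← mul_assoc]
    refine mul_le_mul_of_nonneg_right ?_ he0
    calc ((2 : ℝ) ^ (m - j + 1) - 1) * (2 ^ (m - j)) ^ (r - j)
        ≤ 2 ^ (m - j + 1) * (2 ^ (m - j)) ^ (r - j) := by
          gcongr; linarith
      _ = 2 ^ 1 * (2 ^ (m - j)) ^ (r - j + 1) := by ring
      _ ≤ 2 ^ (r + 3 - j) * (2 ^ (m - j)) ^ (r + 2 - j) := by
          gcongr
          · exact one_le_two
          · omega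
          · omega
  linarith
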